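/- **Theorem (query lower bound for pure-state squared fidelity estimation).** There is an absolute constant $c>0$ such that the following holds for every $\varepsilon\in(0,1/2)$ and every integer $k\ge 1$. Suppose that a quantum query algorithm, for all unitary operators $U_\varphi,U_\psi$ on $k$ qubits, given query access to them, outputs with probability at least $2/3$ an estimate of the squared fidelity $$\mathrm F^2(|\varphi\rangle,|\psi\rangle)=|\langle\varphi|\psi\rangle|^2,\qquad |\varphi\rangle=U_\varphi|0\rangle,\quad |\psi\rangle=U_\psi|0\rangle,$$ to within additive error $\varepsilon$. Then it makes at least $c/\varepsilon$ queries; that is, its query complexity is $\Omega(1/\varepsilon)$. Here a quantum query algorithm with $Q$ queries is a circuit $G_Q\,U_Q\cdots G_1\,U_1\,G_0$ on finitely many qubits, run on the initial state $|0\rangle$, in which each $G_j$ is a quantum gate (unitary operator) that does not depend on the oracles and each $U_j$ is one of $U_\varphi$, $U_\psi$, $U_\varphi^\dagger$, $U_\psi^\dagger$ or a controlled version of one of these, applied to some of the qubits. At the end a subset of the qubits is measured in the computational basis, and the output is a real number computed from the outcome. The query complexity is $Q$, the total number of queries. -/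

import Mathlib

noncomputable section

namespace QuantumQuery

/-- Computational-basis labels of an `n`-qubit system. -/
abbrev Bits (n : ℕ) : Type := Fin n → Fin 2

/-- State vectors of an `n`-qubit system. -/
abbrev Ket (n : ℕ) : Type := EuclideanSpace ℂ (Bits n)

/-- Unitary operators on an `n`-qubit system, as matrices in the computational basis. -/
abbrev Gate (n : ℕ) : Type := Matrix.unitaryGroup (Bits n) ℂ

/-- The state `|0⟩ = |0…0⟩`. -/
def zeroKet (n : ℕ) : Ket n := EuclideanSpace.single (0 : Bits n) (1 : ℂ)

/-- The action of an operator, given by its matrix in the computational basis, on a state. -/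
def act {n : ℕ} (M : Matrix (Bits n) (Bits n) ℂ) (v : Ket n) : Ket n :=
  WithLp.toLp 2 (M.mulVec v.ofLp)

/-- The pure state `U|0⟩` prepared by the unitary `U`. -/
def prepared {k : ℕ} (U : Gate k) : Ket k := act U.1 (zeroKet k)

/-- The square root fidelity `|⟨φ|ψ⟩|` of two pure states. -/
def fidelity {k : ℕ} (φ ψ : Ket k) : ℝ := ‖inner ℂ φ ψ‖

/-- The operator on `n` qubits that acts as `M` on the qubits `e 0, …, e (k-1)` and as the
identity on all other qubits. -/
def onQubits {k n : ℕ} (e : Fin k ↪ Fin n) (M : Matrix (Bits k) (Bits k) ℂ) :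
    Matrix (Bits n) (Bits n) ℂ :=
  fun x y => if ∀ i, (∀ j, e j ≠ i) → x i = y i then M (x ∘ e) (y ∘ e) else 0

/-- The operator `|0⟩⟨0| ⊗ I + |1⟩⟨1| ⊗ M` with control qubit `c`; it is used for operators `M`
that act as the identity on qubit `c`. -/
def controlledBy {n : ℕ} (c : Fin n) (M : Matrix (Bits n) (Bits n) ℂ) :
    Matrix (Bits n) (Bits n) ℂ :=
  fun x y => if y c = 1 then M x y else (1 : Matrix (Bits n) (Bits n) ℂ) x y

/-- One query, inside an `n`-qubit circuit, to one of two unitary oracles on `k` qubits. -/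
structure Query (k n : ℕ) where
  /-- which of the two oracles is queried: the first one if `false`, the second one if `true` -/
  second : Bool
  /-- whether the inverse of the oracle is applied -/
  inverse : Bool
  /-- the qubits on which the oracle acts -/
  register : Fin k ↪ Fin n
  /-- the control qubit of a controlled query, `none` for an uncontrolled query -/
  control : Option (Fin n)
  /-- the control qubit is not one of the qubits on which the oracle acts -/
  control_ne : ∀ c ∈ control, ∀ j, register j ≠ c

/-- The `k`-qubit operator (first or second oracle, or its inverse) applied by a query. -/
def Query.base {k n : ℕ} (q : Query k n) (U V : Gate k) : Gate k :=
  let W := if q.second then V else U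
  if q.inverse then W⁻¹ else W

/-- The `n`-qubit operator applied by a query when the oracles are `U` and `V`. -/
def Query.op {k n : ℕ} (q : Query k n) (U V : Gate k) : Matrix (Bits n) (Bits n) ℂ :=
  match q.control with
  | none => onQubits q.register (q.base U V).1
  | some c => controlledBy c (onQubits q.register (q.base U V).1)

/-- A quantum query algorithm `G_Q · U_Q ⋯ G_1 · U_1 · G_0` on `n` qubits with queries to two
unitary oracles on `k` qubits, which ends with a measurement of some of the qubits in the
computational basis and outputs a real number computed from the measurement outcome. The gates
`G_j` are arbitrary unitaries that do not depend on the oracles; this covers all circuits of one-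
and two-qubit gates. -/
structure Algorithm (k n : ℕ) where
  /-- the gate `G_0` -/
  firstGate : Gate n
  /-- the queries `U_j` with the gates `G_j` that follow them, for `j = 1, …, Q` in this order -/
  steps : List (Query k n × Gate n)
  /-- the qubits that are measured at the end -/
  measured : Finset (Fin n)
  /-- the estimate computed from the measurement outcome -/
  estimate : (measured → Fin 2) → ℝ

namespace Algorithm

variable {k n : ℕ}

/-- The number `Q` of queries, to both oracles together. -/
def queryComplexity (A : Algorithm k n) : ℕ := A.steps.length

/-- The state `G_Q U_Q ⋯ G_1 U_1 G_0 |0⟩` when the oracles are `U` and `V`. -/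
def finalState (A : Algorithm k n) (U V : Gate k) : Ket n :=
  A.steps.foldl (fun v s => act s.2.1 (act (s.1.op U V) v)) (act A.firstGate.1 (zeroKet n))

/-- The projector `P_m` onto the span of the basis states whose measured qubits read `m`. -/
def project (A : Algorithm k n) (m : A.measured → Fin 2) (v : Ket n) : Ket n :=
  WithLp.toLp 2 fun x => if ∀ i : A.measured, x i = m i then v x else 0

/-- The probability `‖P_m 𝒜|0⟩‖²` of the measurement outcome `m`. -/
def outcomeProb (A : Algorithm k n) (U V : Gate k) (m : A.measured → Fin 2) : ℝ :=
  ‖A.project m (A.finalState U V)‖ ^ 2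

open Classical in
/-- The probability that the estimate is within additive error `ε` of the real number `t`. -/
def successProb (A : Algorithm k n) (U V : Gate k) (t ε : ℝ) : ℝ :=
  ∑ m : A.measured → Fin 2, if |A.estimate m - t| ≤ ε then A.outcomeProb U V m else 0

/-- For any two `k`-qubit pure states, given by any oracles that prepare them, the algorithm
estimates their squared fidelity to within additive error `ε` with probability at least `2/3`. -/
def EstimatesSquaredFidelity (A : Algorithm k n) (ε : ℝ) : Prop :=
  ∀ U V : Gate k, 2 / 3 ≤ A.successProb U V (fidelity (prepared U) (prepared V) ^ 2) ε

end Algorithm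

end QuantumQuery

end

/-!
Estimating the squared fidelity to within `ε` distinguishes any two pairs of oracles whose squared
fidelities are more than `2 * ε` apart, and this is hard if the oracles are close to each other.

The first oracle is the identity, so that it prepares `|0⟩`. With `X` the exchange of `|0…0⟩` and
`|1…1⟩`, the second oracle is `a + i b X` for real `a`, `b` with `a² + b² = 1`, which gives the
squared fidelity `a²`. For `a² = (1 + t) / 2` and for `a² = (1 - t) / 2` the squared fidelities
differ by `t`, while the distance of the two oracles in operator norm is only `O(t)`, since
`√((1 + t) / 2) - √((1 - t) / 2) ≤ t` (`exists_close_gates`).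

A query depends on the oracle in a Lipschitz way: extending an operator by the identity to further
qubits, taking the adjoint and adding a control do not increase distances
(`Query.norm_act_op_sub_le`). All steps of the algorithm are contractions, so errors add up over
the queries, and the two final states of an algorithm with `Q` queries are within `Q` times the
distance of the oracles (`Algorithm.norm_finalState_sub_le`). The two sets of outcomes that count as
a success are disjoint, so the probability of one of them has to change from at least `2 / 3` to
at most `1 / 3`, which forces a constant distance of the final states
(`Algorithm.EstimatesSquaredFidelity.one_le_queryComplexity_mul`). The choice `t = min 1 (4 * ε)`
gives `Q = Ω(1 / ε)`.
-/

open scoped Matrix.Norms.L2Operator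

namespace QuantumQuery

/-! ### Operators and projections on qubits -/

section Operators

variable {k n : ℕ}

theorem norm_act_le (M : Matrix (Bits n) (Bits n) ℂ) (v : Ket n) : ‖act M v‖ ≤ ‖M‖ * ‖v‖ :=
  Matrix.l2_opNorm_mulVec M v

theorem act_sub_left (M N : Matrix (Bits n) (Bits n) ℂ) (v : Ket n) :
    act (M - N) v = act M v - act N v := by
  simp [act, Matrix.sub_mulVec]

theorem act_sub_right (M : Matrix (Bits n) (Bits n) ℂ) (v w : Ket n) :
    act M (v - w) = act M v - act M w := by
  simp [act, Matrix.mulVec_sub]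

theorem act_apply (M : Matrix (Bits n) (Bits n) ℂ) (v : Ket n) (x : Bits n) :
    act M v x = ∑ y, M x y * v y := rfl

theorem norm_sq_eq_sum (v : Ket n) : ‖v‖ ^ 2 = ∑ x, ‖v x‖ ^ 2 :=
  EuclideanSpace.norm_sq_eq v

theorem norm_gate_le_one (U : Gate n) : ‖U.1‖ ≤ 1 :=
  (CStarRing.norm_of_mem_unitary U.2).le

theorem norm_act_gate_le (U : Gate n) (v : Ket n) : ‖act U.1 v‖ ≤ ‖v‖ :=
  (norm_act_le _ _).trans (mul_le_of_le_one_left (norm_nonneg _) (norm_gate_le_one U))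

theorem norm_zeroKet (n : ℕ) : ‖zeroKet n‖ = 1 := by
  simp [zeroKet]

/-- A basis label of the whole system is a label of the qubits `e 0, …, e (k-1)` together with a
label of the remaining qubits. -/
noncomputable def splitRegister (e : Fin k ↪ Fin n) :
    Bits n ≃ Bits k × ({i : Fin n // i ∉ Set.range e} → Fin 2) where
  toFun x := (x ∘ e, fun i => x i)
  -- The value `0` is never read: `Function.extend` needs its second function only outside the
  -- range of `e`.
  invFun p := open Classical in
    Function.extend e p.1 fun i => if h : i ∈ Set.range e then 0 else p.2 ⟨i, h⟩
  left_inv x := by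
    funext i
    by_cases h : i ∈ Set.range e
    · obtain ⟨j, rfl⟩ := h
      simp [e.injective.extend_apply]
    · simp only
      rw [Function.extend_apply' _ _ _ h]
      simp only [h, dite_false]
  right_inv p := by
    refine Prod.ext ?_ ?_
    · funext j
      simp [e.injective.extend_apply]
    · funext i
      have h := i.2
      simp only
      rw [Function.extend_apply' _ _ _ h]
      simp only [h, dite_false]

theorem onQubits_splitRegister (e : Fin k ↪ Fin n) (M : Matrix (Bits k) (Bits k) ℂ)
    (a b : Bits k) (r s : {i : Fin n // i ∉ Set.range e} → Fin 2) :
    onQubits e M ((splitRegister e).symm (a, r)) ((splitRegister e).symm (b, s)) =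
      if r = s then M a b else 0 := by
  have key : ∀ c t, (splitRegister e).symm (c, t) ∘ e = c ∧
      (fun i : {i : Fin n // i ∉ Set.range e} => (splitRegister e).symm (c, t) i) = t :=
    fun c t => Prod.ext_iff.1 ((splitRegister e).apply_symm_apply (c, t))
  unfold onQubits
  rw [(key a r).1, (key b s).1]
  congr 1
  conv_rhs => rw [← (key a r).2, ← (key b s).2]
  simp [funext_iff]

/-- Acting on a register does not increase the norm of an operator: the action is block diagonal,
with one copy of the operator for each label of the remaining qubits. -/
theorem norm_onQubits_le (e : Fin k ↪ Fin n) (M : Matrix (Bits k) (Bits k) ℂ) :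
    ‖onQubits e M‖ ≤ ‖M‖ := by
  rw [Matrix.l2_opNorm_def]
  refine ContinuousLinearMap.opNorm_le_bound _ (norm_nonneg _) fun v => ?_
  change ‖act (onQubits e M) v‖ ≤ _
  let block (r : {i : Fin n // i ∉ Set.range e} → Fin 2) (w : Ket n) : Ket k :=
    WithLp.toLp 2 fun a => w ((splitRegister e).symm (a, r))
  have hsum (w : Ket n) : ‖w‖ ^ 2 = ∑ r, ‖block r w‖ ^ 2 := by
    simp_rw [norm_sq_eq_sum]
    rw [← (splitRegister e).symm.sum_comp, Fintype.sum_prod_type_right]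
  have hblock (r) : block r (act (onQubits e M) v) = act M (block r v) := by
    ext a
    change act (onQubits e M) v ((splitRegister e).symm (a, r)) = _
    rw [act_apply, act_apply, ← (splitRegister e).symm.sum_comp, Fintype.sum_prod_type]
    simp [onQubits_splitRegister, block]
  refine le_of_sq_le_sq ?_ (by positivity)
  rw [mul_pow, hsum, hsum, Finset.mul_sum]
  gcongr with r
  rw [hblock, ← mul_pow]
  gcongr
  exact norm_act_le _ _

theorem onQubits_sub (e : Fin k ↪ Fin n) (M N : Matrix (Bits k) (Bits k) ℂ) :
    onQubits e (M - N) = onQubits e M - onQubits e N := by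
  ext x y
  simp only [onQubits, Matrix.sub_apply]
  split_ifs <;> simp

open Classical in
/-- The projection of a state onto the span of the basis states whose labels satisfy `p`. -/
noncomputable def restrict (p : Bits n → Prop) (v : Ket n) : Ket n :=
  WithLp.toLp 2 fun x => if p x then v x else 0

open Classical in
theorem norm_sq_restrict (p : Bits n → Prop) (v : Ket n) :
    ‖restrict p v‖ ^ 2 = ∑ x, if p x then ‖v x‖ ^ 2 else 0 := by
  rw [norm_sq_eq_sum]
  refine Finset.sum_congr rfl fun x _ => ?_
  simp only [restrict]
  split_ifs <;> simp

theorem norm_restrict_le (p : Bits n → Prop) (v : Ket n) : ‖restrict p v‖ ≤ ‖v‖ := by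
  refine le_of_sq_le_sq ?_ (norm_nonneg _)
  rw [norm_sq_restrict, norm_sq_eq_sum]
  gcongr
  split_ifs <;> simp

theorem restrict_sub (p : Bits n → Prop) (v w : Ket n) :
    restrict p (v - w) = restrict p v - restrict p w := by
  ext x
  simp only [restrict, PiLp.sub_apply]
  split_ifs <;> simp

theorem norm_sq_restrict_add_norm_sq_restrict_le {p q : Bits n → Prop}
    (hpq : ∀ x, p x → ¬ q x) (v : Ket n) :
    ‖restrict p v‖ ^ 2 + ‖restrict q v‖ ^ 2 ≤ ‖v‖ ^ 2 := by
  rw [norm_sq_restrict, norm_sq_restrict, norm_sq_eq_sum, ← Finset.sum_add_distrib]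
  gcongr with x
  have := hpq x
  by_cases h : p x <;> by_cases h' : q x <;> simp_all

/-- Measurement probabilities are Lipschitz in the state, since
`x ^ 2 - y ^ 2 = (x + y) * (x - y)`. -/
theorem norm_sq_restrict_sub_le (p : Bits n → Prop) {v w : Ket n} (hv : ‖v‖ ≤ 1) (hw : ‖w‖ ≤ 1) :
    ‖restrict p v‖ ^ 2 - ‖restrict p w‖ ^ 2 ≤ 2 * ‖v - w‖ := by
  have h1 := (norm_restrict_le p v).trans hv
  have h2 := (norm_restrict_le p w).trans hw
  have h3 : ‖restrict p v‖ - ‖restrict p w‖ ≤ ‖v - w‖ := by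
    refine (norm_sub_norm_le _ _).trans ?_
    rw [← restrict_sub]
    exact norm_restrict_le _ _
  nlinarith [norm_nonneg (restrict p v), norm_nonneg (restrict p w), norm_nonneg (v - w)]

theorem act_controlledBy_sub (c : Fin n) (M N : Matrix (Bits n) (Bits n) ℂ) (v : Ket n) :
    act (controlledBy c M - controlledBy c N) v = act (M - N) (restrict (fun x => x c = 1) v) := by
  ext x
  rw [act_apply, act_apply]
  refine Finset.sum_congr rfl fun y _ => ?_
  simp only [controlledBy, restrict, Matrix.sub_apply]
  split_ifs <;> simp

/-- Controlled operators remain contractions: the branch with control `0` is left alone, and the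
operator maps the branch with control `1` to itself because it does not touch the control qubit. -/
theorem norm_act_controlledBy_onQubits_le (c : Fin n) (e : Fin k ↪ Fin n) (hc : ∀ j, e j ≠ c)
    {M : Matrix (Bits k) (Bits k) ℂ} (hM : ‖M‖ ≤ 1) (v : Ket n) :
    ‖act (controlledBy c (onQubits e M)) v‖ ≤ ‖v‖ := by
  set w := restrict (fun x => x c = 1) v with hw
  have hzero (x y : Bits n) (hxy : x c ≠ y c) : onQubits e M x y = 0 :=
    if_neg fun h => hxy (h c hc)
  have hon (x : Bits n) (hx : x c = 1) :
      act (controlledBy c (onQubits e M)) v x = act (onQubits e M) w x := by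
    rw [act_apply, act_apply]
    refine Finset.sum_congr rfl fun y _ => ?_
    simp only [controlledBy, hw, restrict]
    split_ifs with hy
    · rfl
    · rw [Matrix.one_apply_ne (by rintro rfl; exact hy hx), zero_mul, mul_zero]
  have hoff (x : Bits n) (hx : ¬ x c = 1) : act (controlledBy c (onQubits e M)) v x = v x := by
    rw [act_apply, Finset.sum_eq_single x]
    · simp [controlledBy, hx]
    · intro y _ hyx
      simp only [controlledBy]
      split_ifs with hy
      · rw [hzero x y (by rwa [hy]), zero_mul]
      · rw [Matrix.one_apply_ne hyx.symm, zero_mul]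
    · simp
  have hMw : ‖act (onQubits e M) w‖ ≤ ‖w‖ :=
    (norm_act_le _ _).trans
      (mul_le_of_le_one_left (norm_nonneg _) ((norm_onQubits_le e M).trans hM))
  refine le_of_sq_le_sq ?_ (norm_nonneg _)
  calc ‖act (controlledBy c (onQubits e M)) v‖ ^ 2
      ≤ ‖act (onQubits e M) w‖ ^ 2 + ‖restrict (fun x => ¬ x c = 1) v‖ ^ 2 := by
        rw [norm_sq_restrict, norm_sq_eq_sum, norm_sq_eq_sum, ← Finset.sum_add_distrib]
        gcongr with x
        by_cases hx : x c = 1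
        · simp [hon x hx, hx]
        · simp [hoff x hx, hx]
    _ ≤ ‖w‖ ^ 2 + ‖restrict (fun x => ¬ x c = 1) v‖ ^ 2 := by gcongr
    _ ≤ ‖v‖ ^ 2 := norm_sq_restrict_add_norm_sq_restrict_le (fun x h => not_not.2 h) v

end Operators

/-! ### Dependence of a query on the oracle -/

namespace Query

variable {k n : ℕ}

theorem norm_act_op_le (q : Query k n) (U V : Gate k) (v : Ket n) : ‖act (q.op U V) v‖ ≤ ‖v‖ := by
  unfold op
  split
  · exact (norm_act_le _ _).trans (mul_le_of_le_one_left (norm_nonneg _)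
      ((norm_onQubits_le _ _).trans (norm_gate_le_one _)))
  · next c hc =>
    exact norm_act_controlledBy_onQubits_le c _ (q.control_ne c hc) (norm_gate_le_one _) v

theorem norm_base_sub_le (q : Query k n) (U V W : Gate k) :
    ‖(q.base U V).1 - (q.base U W).1‖ ≤ ‖V.1 - W.1‖ := by
  unfold base
  cases q.second <;> cases q.inverse
  · simp
  · simp
  · simp
  · change ‖star V.1 - star W.1‖ ≤ _
    rw [← star_sub, norm_star]

theorem norm_act_op_sub_le (q : Query k n) (U V W : Gate k) (v : Ket n) :
    ‖act (q.op U V) v - act (q.op U W) v‖ ≤ ‖V.1 - W.1‖ * ‖v‖ := by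
  have key (w : Ket n) :
      ‖act (onQubits q.register (q.base U V).1 - onQubits q.register (q.base U W).1) w‖ ≤
        ‖V.1 - W.1‖ * ‖w‖ := by
    rw [← onQubits_sub]
    refine (norm_act_le _ _).trans ?_
    gcongr
    exact (norm_onQubits_le _ _).trans (q.norm_base_sub_le U V W)
  rw [← act_sub_left]
  unfold op
  split
  · exact key v
  · rw [act_controlledBy_sub]
    refine (key _).trans ?_
    gcongr
    exact norm_restrict_le _ _

end Query

/-! ### The hybrid argument -/

namespace Algorithm

variable {k n : ℕ}

theorem norm_finalState_le (A : Algorithm k n) (U V : Gate k) : ‖A.finalState U V‖ ≤ 1 := by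
  have key (l : List (Query k n × Gate n)) (v : Ket n) :
      ‖l.foldl (fun v s => act s.2.1 (act (s.1.op U V) v)) v‖ ≤ ‖v‖ := by
    induction l generalizing v with
    | nil => exact le_rfl
    | cons s l ih =>
      exact (ih _).trans ((norm_act_gate_le _ _).trans (s.1.norm_act_op_le U V v))
  exact (key _ _).trans ((norm_act_gate_le _ _).trans (norm_zeroKet n).le)

/-- The hybrid argument: replacing an oracle changes the final state by at most the distance
of the two oracles for every query. -/
theorem norm_finalState_sub_le (A : Algorithm k n) (U V W : Gate k) :
    ‖A.finalState U V - A.finalState U W‖ ≤ A.queryComplexity * ‖V.1 - W.1‖ := by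
  have key (l : List (Query k n × Gate n)) (v w : Ket n) (hv : ‖v‖ ≤ 1) :
      ‖l.foldl (fun v s => act s.2.1 (act (s.1.op U V) v)) v -
        l.foldl (fun v s => act s.2.1 (act (s.1.op U W) v)) w‖ ≤
          l.length * ‖V.1 - W.1‖ + ‖v - w‖ := by
    induction l generalizing v w with
    | nil => simp
    | cons s l ih =>
      refine (ih (act s.2.1 (act (s.1.op U V) v)) (act s.2.1 (act (s.1.op U W) w))
        ((norm_act_gate_le _ _).trans ((s.1.norm_act_op_le U V v).trans hv))).trans ?_
      have hstep : ‖act s.2.1 (act (s.1.op U V) v) - act s.2.1 (act (s.1.op U W) w)‖ ≤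
          ‖V.1 - W.1‖ + ‖v - w‖ := by
        rw [← act_sub_right]
        refine (norm_act_gate_le _ _).trans ?_
        rw [← sub_add_sub_cancel _ (act (s.1.op U W) v), ← act_sub_right]
        refine (norm_add_le _ _).trans (add_le_add ?_ (s.1.norm_act_op_le U W _))
        exact (s.1.norm_act_op_sub_le U V W v).trans
          (mul_le_of_le_one_right (norm_nonneg _) hv)
      rw [List.length_cons]
      push_cast
      linarith
  simpa [finalState, queryComplexity] using
    key A.steps (act A.firstGate.1 (zeroKet n)) (act A.firstGate.1 (zeroKet n))
      ((norm_act_gate_le _ _).trans (norm_zeroKet n).le)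

/-- The success probability is the squared norm of one projection of the final state. -/
theorem successProb_eq (A : Algorithm k n) (U V : Gate k) (t ε : ℝ) :
    A.successProb U V t ε =
      ‖restrict (fun x => |A.estimate (fun i => x i) - t| ≤ ε) (A.finalState U V)‖ ^ 2 := by
  classical
  have hproj (m : A.measured → Fin 2) : A.outcomeProb U V m =
      ∑ x, if m = (fun i => x i) then ‖A.finalState U V x‖ ^ 2 else 0 := by
    rw [outcomeProb, norm_sq_eq_sum]
    refine Finset.sum_congr rfl fun x _ => ?_
    simp only [project, funext_iff, eq_comm (a := m _)]
    split_ifs <;> simp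
  rw [successProb, norm_sq_restrict]
  simp_rw [hproj, ← Finset.sum_filter (fun m => |A.estimate m - t| ≤ ε)]
  rw [Finset.sum_comm]
  refine Finset.sum_congr rfl fun x _ => ?_
  simp [Finset.sum_ite_eq']

/-- An algorithm that estimates squared fidelities to within `ε` distinguishes any two oracles
whose squared fidelities are more than `2 * ε` apart, so its final states for them are far from
each other. -/
theorem EstimatesSquaredFidelity.one_le_queryComplexity_mul {A : Algorithm k n} {ε : ℝ}
    (hA : A.EstimatesSquaredFidelity ε) (U V W : Gate k)
    (hVW : 2 * ε <
      fidelity (prepared U) (prepared V) ^ 2 - fidelity (prepared U) (prepared W) ^ 2) :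
    1 ≤ A.queryComplexity * (6 * ‖V.1 - W.1‖) := by
  have hV := hA U V
  have hW := hA U W
  rw [successProb_eq] at hV hW
  have hdisj := norm_sq_restrict_add_norm_sq_restrict_le
    (p := fun x => |A.estimate (fun i => x i) - fidelity (prepared U) (prepared V) ^ 2| ≤ ε)
    (q := fun x => |A.estimate (fun i => x i) - fidelity (prepared U) (prepared W) ^ 2| ≤ ε)
    (fun x h h' => by rw [abs_le] at h h'; linarith) (A.finalState U W)
  have hnorm : ‖A.finalState U W‖ ^ 2 ≤ 1 :=
    pow_le_one₀ (norm_nonneg _) (A.norm_finalState_le U W)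
  have hlip := norm_sq_restrict_sub_le
    (fun x => |A.estimate (fun i => x i) - fidelity (prepared U) (prepared V) ^ 2| ≤ ε)
    (A.norm_finalState_le U V) (A.norm_finalState_le U W)
  linarith [A.norm_finalState_sub_le U V W]

end Algorithm

/-! ### Close oracles with different fidelities -/

section HardInstances

variable {k : ℕ}

/-- The Hermitian involution that exchanges `|0…0⟩` and `|1…1⟩` and fixes every other basis
state. -/
def flip (k : ℕ) : Matrix (Bits k) (Bits k) ℂ :=
  (Equiv.swap (0 : Bits k) 1).permMatrix ℂ

theorem flip_mul_flip (k : ℕ) : flip k * flip k = 1 := by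
  rw [flip, ← Matrix.permMatrix_mul, Equiv.swap_mul_self, Matrix.permMatrix_one]

theorem star_flip (k : ℕ) : star (flip k) = flip k := by
  rw [flip, Matrix.star_eq_conjTranspose, Matrix.conjTranspose_permMatrix, Equiv.swap_inv]

theorem norm_flip_le (k : ℕ) : ‖flip k‖ ≤ 1 :=
  Matrix.permMatrix_l2_opNorm_le _

theorem flip_zero_zero (hk : 1 ≤ k) : flip k 0 0 = 0 := by
  have h : (1 : Bits k) ≠ 0 := fun h => by simpa using congrFun h ⟨0, hk⟩
  simp [flip, Equiv.Perm.permMatrix, PEquiv.toMatrix_apply, h]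

/-- The rotation `a + i b X`, where `X` exchanges `|0…0⟩` and `|1…1⟩`. -/
noncomputable def rotation (k : ℕ) {a b : ℝ} (hab : a ^ 2 + b ^ 2 = 1) : Gate k :=
  ⟨(a : ℂ) • 1 + (Complex.I * b) • flip k, by
    rw [Matrix.mem_unitaryGroup_iff]
    have h : (a : ℂ) ^ 2 + (b : ℂ) ^ 2 = 1 := by exact_mod_cast hab
    simp only [star_add, star_smul, star_one, star_flip, add_mul, mul_add, smul_mul_assoc,
      mul_smul_comm, flip_mul_flip, mul_one, one_mul]
    simp only [star_mul', RCLike.star_def, Complex.conj_ofReal, Complex.conj_I]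
    match_scalars
    · linear_combination h - (b : ℂ) ^ 2 * Complex.I_sq
    · ring⟩

theorem norm_rotation_sub_le (k : ℕ) {a b a' b' : ℝ} (h : a ^ 2 + b ^ 2 = 1)
    (h' : a' ^ 2 + b' ^ 2 = 1) :
    ‖(rotation k h).1 - (rotation k h').1‖ ≤ |a - a'| + |b - b'| := by
  have heq : (rotation k h).1 - (rotation k h').1 =
      ((a - a' : ℝ) : ℂ) • 1 + (Complex.I * ((b - b' : ℝ) : ℂ)) • flip k := by
    simp only [rotation]
    push_cast
    module
  rw [heq]
  refine (norm_add_le _ _).trans (add_le_add ?_ ?_)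
  · refine (norm_smul_le _ _).trans ?_
    rw [Complex.norm_real, Real.norm_eq_abs]
    exact mul_le_of_le_one_right (abs_nonneg _) (norm_gate_le_one (1 : Gate k))
  · refine (norm_smul_le _ _).trans ?_
    rw [norm_mul, Complex.norm_I, one_mul, Complex.norm_real, Real.norm_eq_abs]
    exact mul_le_of_le_one_right (abs_nonneg _) (norm_flip_le k)

theorem fidelity_one_rotation (hk : 1 ≤ k) {a b : ℝ} (hab : a ^ 2 + b ^ 2 = 1) :
    fidelity (prepared 1) (prepared (rotation k hab)) ^ 2 = a ^ 2 := by
  have h1 : prepared (1 : Gate k) = zeroKet k := by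
    simp [prepared, act]
  have h2 : prepared (rotation k hab) 0 = a := by
    simp [prepared, act, zeroKet, rotation, flip_zero_zero hk]
  rw [fidelity, h1, zeroKet, EuclideanSpace.inner_single_left, h2]
  simp

/-- Two rotations with cosines `√((1 + t) / 2)` and `√((1 - t) / 2)` exchange the roles of sine and
cosine; their squared fidelities with the identity differ by `t`, and their distance is `O(t)`. -/
theorem exists_close_gates (hk : 1 ≤ k) {t : ℝ} (ht0 : 0 ≤ t) (ht1 : t ≤ 1) :
    ∃ V W : Gate k, fidelity (prepared 1) (prepared V) ^ 2 -
      fidelity (prepared 1) (prepared W) ^ 2 = t ∧ ‖V.1 - W.1‖ ≤ 2 * t := by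
  set a := √((1 + t) / 2) with ha
  set b := √((1 - t) / 2) with hb
  have ha2 : a ^ 2 = (1 + t) / 2 := Real.sq_sqrt (by linarith)
  have hb2 : b ^ 2 = (1 - t) / 2 := Real.sq_sqrt (by linarith)
  have ha0 : 0 ≤ a := Real.sqrt_nonneg _
  have hb0 : 0 ≤ b := Real.sqrt_nonneg _
  have hba : b ≤ a := Real.sqrt_le_sqrt (by linarith)
  have hsum : 1 ≤ a + b := by nlinarith
  refine ⟨rotation k (a := a) (b := b) (by linarith), rotation k (a := b) (b := a) (by linarith),
    ?_, ?_⟩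
  · rw [fidelity_one_rotation hk, fidelity_one_rotation hk]
    linarith
  · refine (norm_rotation_sub_le k _ _).trans ?_
    rw [abs_sub_comm b a, abs_of_nonneg (sub_nonneg.2 hba)]
    -- `(a - b) (a + b) = t` and `a + b ≥ 1`
    nlinarith

end HardInstances

end QuantumQuery

theorem mainTheorem6 :
    ∃ c : ℝ, 0 < c ∧
      ∀ ε : ℝ, 0 < ε → ε < 1 / 2 →
        ∀ k n : ℕ, 1 ≤ k →
          ∀ A : QuantumQuery.Algorithm k n, A.EstimatesSquaredFidelity ε →
            c / ε ≤ (A.queryComplexity : ℝ) := by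
  refine ⟨1 / 48, by norm_num, fun ε hε hε2 k n hk A hA => ?_⟩
  -- The gap must exceed `2 * ε`, must be `O(ε)`, and cannot exceed `1`.
  obtain ⟨V, W, hgap, hdist⟩ := QuantumQuery.exists_close_gates hk (t := min 1 (4 * ε))
    (by positivity) (min_le_left _ _)
  have hlt : 2 * ε < min 1 (4 * ε) := lt_min (by linarith) (by linarith)
  have hQ := hA.one_le_queryComplexity_mul 1 V W (by rwa [hgap])
  have hsmall : 6 * ‖V.1 - W.1‖ ≤ 48 * ε := by linarith [min_le_right 1 (4 * ε)]
  have := hQ.trans (mul_le_mul_of_nonneg_left hsmall (Nat.cast_nonneg _))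
  rw [div_le_iff₀ hε]
  linarith
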